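/- Let $B,U,Q$ be positive integers, $H\in\mathbb C^{B\times U}$, $r\in\mathbb C^B$, $\alpha_1,\dots,\alpha_Q\ge 0$ and $\rho\in\mathbb R$. Let $\tilde{\mathcal X}=\{a+jb : a,b\in[-1,1]\}\subset\mathbb C$, and consider the box-constrained penalized maximum-likelihood problem $$\min_{x_1,\dots,x_Q\in\tilde{\mathcal X}^U} F(x_1,\dots,x_Q),\qquad F(x_1,\dots,x_Q)=\tfrac12\Big\|r-H\Big(\sum_{q=1}^Q2^{q-1}x_q\Big)\Big\|_2^2-\sum_{q=1}^Q\tfrac{\alpha_q}{2}\|x_q\|_2^2 .\qquad(5)$$ From arbitrary initial vectors $x_1^1,\dots,x_Q^1,x_0^1,y^1\in\mathbb C^U$ the PS-ADMM algorithm generates, for $k=1,2,\dots$, $$x_q^{k+1}=\Pi\Big(\tfrac{2^{q-1}}{4^{q-1}\rho-\alpha_q}\Big(\rho x_0^k-\rho\sum_{i<q}2^{i-1}x_i^{k+1}-\rho\sum_{i>q}2^{i-1}x_i^k+y^k\Big)\Big)\quad\text{successively for } q=1,\dots,Q,$$ $$x_0^{k+1}=(H^HH+\rho I)^{-1}\Big(H^Hr+\rho\sum_{q=1}^Q2^{q-1}x_q^{k+1}-y^k\Big),\qquad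 y^{k+1}=y^k+\rho\Big(x_0^{k+1}-\sum_{q=1}^Q2^{q-1}x_q^{k+1}\Big),$$ where $\Pi$ projects the real and the imaginary part of every entry onto $[-1,1]$. Assume that $4^{q-1}\rho>\alpha_q$ for all $q=1,\dots,Q$ and that $\rho>\sqrt2\,\lambda_{\max}(H^HH)$. Then there are $x_1^*,\dots,x_Q^*,x_0^*,y^*\in\mathbb C^U$ such that, as $k\to\infty$, $x_q^k\to x_q^*$ for every $q$, $x_0^k\to x_0^*$ and $y^k\to y^*$; moreover $x_0^*=\sum_{q=1}^Q2^{q-1}x_q^*$, and $(x_1^*,\dots,x_Q^*)$ is a stationary point of problem (5): $x_q^*\in\tilde{\mathcal X}^U$ for every $q$, and $$\mathrm{Re}\big\langle\nabla_{x_q}F(x_1^*,\dots,x_Q^*),\,x_q-x_q^*\big\rangle\ge0\qquad\text{for all }x_q\in\tilde{\mathcal X}^U\text{ and all }q=1,\dots,Q,$$ where $\nabla_{x_q}$ is the partial gradient with respect to $x_q$, with $\mathbb C^U$ regarded as a real inner product space under $\mathrm{Re}\langle\cdot,\cdot\rangle$. -/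

import Mathlib

open Filter Topology
open scoped Matrix

namespace PSADMM

noncomputable section

/-- Complex vectors of length `n` with the Euclidean norm. -/
abbrev CVec (n : ℕ) : Type := EuclideanSpace ℂ (Fin n)

/-- The largest eigenvalue of the Hermitian matrix `Hᴴ * H`. -/
def lamMax {B U : ℕ} (H : Matrix (Fin B) (Fin U) ℂ) : ℝ :=
  ⨆ i : Fin U, (Matrix.isHermitian_conjTranspose_mul_self H).eigenvalues i

/-- Vectors whose entries have real and imaginary parts in `[-1, 1]`. -/
def box (U : ℕ) : Set (CVec U) :=
  {v | ∀ i, (v i).re ∈ Set.Icc (-1 : ℝ) 1 ∧ (v i).im ∈ Set.Icc (-1 : ℝ) 1}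

/-- Projection of the real number `t` onto `[-1, 1]`. -/
def clip (t : ℝ) : ℝ := max (-1) (min 1 t)

/-- Entrywise projection of the real and the imaginary parts onto `[-1, 1]`. -/
def boxProj {U : ℕ} (v : CVec U) : CVec U :=
  WithLp.toLp 2 fun i => (⟨clip (v i).re, clip (v i).im⟩ : ℂ)

/-- The weighted sum `∑_{q=1}^{Q} 2^(q-1) x_q`. The index `q : Fin Q` starts at `0`, so that the
weight of `x q` is `2 ^ q`. -/
def wsum {Q U : ℕ} (x : Fin Q → CVec U) : CVec U :=
  ∑ q : Fin Q, (2 : ℝ) ^ (q : ℕ) • x q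

/-- The least squares loss `‖r - H v‖² / 2`. -/
def loss {B U : ℕ} (H : Matrix (Fin B) (Fin U) ℂ) (r : CVec B) (v : CVec U) : ℝ :=
  1 / 2 * ‖r - Matrix.toEuclideanLin H v‖ ^ 2

/-- The penalized objective `‖r - H (∑ 2^(q-1) x_q)‖² / 2 - ∑ (α_q / 2) ‖x_q‖²`. -/
def objective {B U Q : ℕ} (H : Matrix (Fin B) (Fin U) ℂ) (r : CVec B) (α : Fin Q → ℝ)
    (x : Fin Q → CVec U) : ℝ :=
  loss H r (wsum x) - ∑ q : Fin Q, α q / 2 * ‖x q‖ ^ 2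

/-- The partial gradient of the objective with respect to the block `x_q`, where `ℂ^U` is regarded
as a real inner product space with inner product `Re ⟪·, ·⟫`. -/
def blockGradient {B U Q : ℕ} (H : Matrix (Fin B) (Fin U) ℂ) (r : CVec B) (α : Fin Q → ℝ)
    (x : Fin Q → CVec U) (q : Fin Q) : CVec U :=
  gradient (𝕜 := ℝ) (fun z : CVec U => objective H r α (Function.update x q z)) (x q)

/-- `x` is a stationary point of the problem of minimizing the objective subject to `x_q ∈ box`:
it is feasible and satisfies the variational inequality in every block. -/
def IsStationaryPoint {B U Q : ℕ} (H : Matrix (Fin B) (Fin U) ℂ) (r : CVec B) (α : Fin Q → ℝ)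
    (x : Fin Q → CVec U) : Prop :=
  (∀ q, x q ∈ box U) ∧
    ∀ q, ∀ z ∈ box U, 0 ≤ (inner ℂ (blockGradient H r α x q) (z - x q)).re

/-- The sequences `x k = (x_1^k, …, x_Q^k)`, `x₀ k` and `y k` are generated by the PS-ADMM
algorithm. The initial values `x 0`, `x₀ 0`, `y 0` are arbitrary. In `x_update`, blocks with an
index below `q` have already been updated in the current sweep. -/
structure IsPSADMM {B U Q : ℕ} (H : Matrix (Fin B) (Fin U) ℂ) (r : CVec B) (ρ : ℝ)
    (α : Fin Q → ℝ) (x : ℕ → Fin Q → CVec U) (x₀ y : ℕ → CVec U) : Prop where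
  x_update : ∀ k q, x (k + 1) q =
    boxProj (((2 : ℝ) ^ (q : ℕ) / (4 ^ (q : ℕ) * ρ - α q)) •
      (ρ • x₀ k - ρ • (∑ i ∈ Finset.Iio q, (2 : ℝ) ^ (i : ℕ) • x (k + 1) i)
        - ρ • (∑ i ∈ Finset.Ioi q, (2 : ℝ) ^ (i : ℕ) • x k i) + y k))
  x₀_update : ∀ k, x₀ (k + 1) =
    Matrix.toEuclideanLin ((Hᴴ * H + (ρ : ℂ) • (1 : Matrix (Fin U) (Fin U) ℂ))⁻¹)
      (Matrix.toEuclideanLin Hᴴ r + ρ • wsum (x (k + 1)) - y k)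
  y_update : ∀ k, y (k + 1) = y k + ρ • (x₀ (k + 1) - wsum (x (k + 1)))

end

end PSADMM

/-! Optimality of the `x₀`-update together with the multiplier step forces `y = Hᴴ r - Hᴴ H x₀`
after each iteration, so multiplier steps are bounded by `lamMax H` times the steps of `x₀`. The
augmented Lagrangian is a quadratic function of `(x, x₀, y)`. In one iteration the blocks lower it
with curvatures `4 ^ q * ρ - α q > 0`, and the dual ascent `ρ⁻¹ * ‖Δy‖ ^ 2` is absorbed by `ρ / 2 *
‖Δx₀‖ ^ 2` because `ρ > √2 * lamMax H`. Hence the decrease dominates a multiple of the squared step,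
and the iterates stay bounded (`exists_tendsto_of_sweep_descent`).

Descent alone only makes the steps vanish. Convergence of the whole sequence comes from a
Łojasiewicz inequality with exponent 1/2 (`quadratic_sub_le_mul_sq`), applied to faces of the box:
along the coordinates not at `±1`, the derivative at an iterate is linear in the last step. There
are finitely many faces, and near an accumulation point `w` the affine span of the face of each
iterate contains `w`. So the excess over the limit value is at most a constant times the squared
last step; its square root then telescopes and bounds the path length
(`exists_tendsto_of_quadratic_descent`). Stationarity follows by passing to the limit in the
variational inequality of each projection. -/

namespace PSADMM

/-! ### Convergence of descent sequences for quadratic functions. -/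

/-- A sequence whose steps are controlled by a telescoping null sequence near a subsequential limit
converges to that limit. -/
theorem tendsto_of_subseq_of_dist_le {E : Type*} [PseudoMetricSpace E] {z : ℕ → E} {w : E}
    {φ : ℕ → ℕ} (hφ : StrictMono φ) (hz : Tendsto (z ∘ φ) atTop (𝓝 w)) {a : ℕ → ℝ}
    (ha0 : ∀ k, 0 ≤ a k) (ha : Tendsto a atTop (𝓝 0)) {M ε : ℝ} (hM : 0 ≤ M) (hε : 0 < ε)
    (h : ∀ᶠ k in atTop, dist (z k) w < ε → dist (z k) (z (k + 1)) ≤ M * (a k - a (k + 1))) :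
    Tendsto z atTop (𝓝 w) := by
  obtain ⟨N, hN⟩ := eventually_atTop.1 h
  rw [Metric.tendsto_atTop]
  intro η hη
  set r := min η ε
  have hr : 0 < r := lt_min hη hε
  have h1 : ∀ᶠ k in atTop, M * a k < r / 2 := by
    have : Tendsto (fun k => M * a k) atTop (𝓝 0) := by simpa using ha.const_mul M
    exact this.eventually (gt_mem_nhds (by positivity))
  have h2 : ∀ᶠ k in atTop, dist (z (φ k)) w < r / 2 :=
    (Metric.tendsto_nhds.1 hz) _ (by positivity)
  obtain ⟨j, ⟨hj1, hj2⟩, hj3⟩ :=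
    (((hφ.tendsto_atTop.eventually h1).and h2).and
      (hφ.tendsto_atTop.eventually (eventually_ge_atTop N))).exists
  -- The induction also keeps `z n` inside the `ε`-ball where the step bound is valid: the
  -- right-hand side stays below `r ≤ ε`.
  have key : ∀ n ≥ φ j, dist (z n) w ≤ dist (z (φ j)) w + M * (a (φ j) - a n) := by
    intro n hn
    induction n, hn using Nat.le_induction with
    | base => simp
    | succ n hn ih =>
      have hlt : dist (z n) w < ε := by
        have := mul_nonneg hM (ha0 n)
        have : r ≤ ε := min_le_right _ _
        nlinarith
      have hs := hN n (hj3.trans hn) hlt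
      have ht := dist_triangle_left (z (n + 1)) w (z n)
      linarith
  refine ⟨φ j, fun n hn => ?_⟩
  have := key n hn
  have := mul_nonneg hM (ha0 n)
  have : r ≤ η := min_le_left _ _
  linarith

/-- Every linear map between vector spaces has a generalized inverse. -/
theorem exists_generalized_inverse {V W : Type*} [AddCommGroup V] [Module ℝ V] [AddCommGroup W]
    [Module ℝ W] (A : V →ₗ[ℝ] W) : ∃ B : W →ₗ[ℝ] V, ∀ v, A (B (A v)) = A v := by
  obtain ⟨g, hg⟩ := A.rangeRestrict.exists_rightInverse_of_surjective A.range_rangeRestrict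
  obtain ⟨B, hB⟩ := g.exists_extend
  refine ⟨B, fun v => ?_⟩
  have h1 : B (A v) = g (A.rangeRestrict v) := by
    rw [← hB]; rfl
  rw [h1]
  have := congrArg Subtype.val (LinearMap.congr_fun hg (A.rangeRestrict v))
  simpa using this

variable {E : Type*} [NormedAddCommGroup E] [NormedSpace ℝ E] [FiniteDimensional ℝ E]

theorem exists_norm_apply_le_mul {F : Type*} [NormedAddCommGroup F] [NormedSpace ℝ F]
    (B : E →ₗ[ℝ] F) : ∃ C, 0 ≤ C ∧ ∀ v, ‖B v‖ ≤ C * ‖v‖ :=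
  ⟨‖LinearMap.toContinuousLinearMap B‖, norm_nonneg _,
    fun v => (LinearMap.toContinuousLinearMap B).le_opNorm v⟩

/-- A symmetric bilinear form on a finite dimensional space satisfies `b d d ≤ C * ‖b d‖ ^ 2`. -/
theorem exists_apply_self_le_mul_norm_sq (b : E →L[ℝ] E →L[ℝ] ℝ) (hb : ∀ u v, b u v = b v u) :
    ∃ C, 0 ≤ C ∧ ∀ d, b d d ≤ C * ‖b d‖ ^ 2 := by
  obtain ⟨B, hB⟩ := exists_generalized_inverse (b : E →ₗ[ℝ] E →L[ℝ] ℝ)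
  obtain ⟨C, hC0, hC⟩ := exists_norm_apply_le_mul B
  refine ⟨C, hC0, fun d => ?_⟩
  -- `d` and `B (b d)` differ by an element of the kernel of `b`, so `b d d` depends on `d` only
  -- through `b d`.
  have h1 : b d d = b d (B (b d)) := by
    rw [hb d (B (b d))]
    exact (DFunLike.congr_fun (hB d) d).symm
  rw [h1]
  calc b d (B (b d)) ≤ ‖b d (B (b d))‖ := Real.le_norm_self _
    _ ≤ ‖b d‖ * ‖B (b d)‖ := (b d).le_opNorm _
    _ ≤ ‖b d‖ * (C * ‖b d‖) := by gcongr; exact hC _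
    _ = _ := by ring

/-- On a subspace, a symmetric bilinear form `b` satisfies `b d d ≤ C * ‖b d ·‖ ^ 2`. -/
theorem exists_apply_self_le_mul_sq (b : E →L[ℝ] E →L[ℝ] ℝ) (hb : ∀ u v, b u v = b v u)
    (V : Submodule ℝ E) :
    ∃ C, 0 ≤ C ∧ ∀ d ∈ V, ∀ M, 0 ≤ M → (∀ v ∈ V, |b d v| ≤ M * ‖v‖) → b d d ≤ C * M ^ 2 := by
  obtain ⟨C, hC0, hC⟩ := exists_apply_self_le_mul_norm_sq
    (b.bilinearComp V.subtypeL V.subtypeL) (fun u v => hb u v)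
  refine ⟨C, hC0, fun d hd M hM h => (hC ⟨d, hd⟩).trans ?_⟩
  gcongr
  exact ContinuousLinearMap.opNorm_le_bound _ hM fun v => h v v.2

/-- A quadratic function satisfies, along a subspace `V`, the Łojasiewicz inequality with
exponent `1 / 2`, where `m Δ` bounds the derivative on `V`. -/
theorem quadratic_sub_le_mul_sq (b m : E →L[ℝ] E →L[ℝ] ℝ) (hb : ∀ u v, b u v = b v u)
    (l : E →L[ℝ] ℝ) (V : Submodule ℝ E) (w : E) :
    ∃ C, 0 ≤ C ∧ ∀ᶠ p : E × E in 𝓝 (w, 0), p.1 - w ∈ V →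
      (∀ d ∈ V, b p.1 d + l d = m p.2 d) →
        (b p.1 p.1 / 2 + l p.1) - (b w w / 2 + l w) ≤ C * ‖p.2‖ ^ 2 := by
  by_cases hw : ∀ d ∈ V, b w d + l d = 0
  -- If `w` is critical along `V`, the increment of the quadratic from `w` is purely second order,
  -- `b (z - w) (z - w) / 2`, and its derivative along `V` is `m Δ`.
  · obtain ⟨C, hC, h⟩ := exists_apply_self_le_mul_sq b hb V
    refine ⟨C * ‖m‖ ^ 2, by positivity, Eventually.of_forall ?_⟩
    rintro ⟨z, Δ⟩ hz hD
    simp only at hz hD ⊢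
    have h1 := h (z - w) hz (‖m‖ * ‖Δ‖) (by positivity) fun v hv => by
      have e1 := hD v hv
      have e2 := hw v hv
      have e3 : b (z - w) v = m Δ v := by
        simp only [map_sub, _root_.sub_apply]; linarith
      rw [e3]
      exact m.le_opNorm₂ Δ v
    have h2 := hw _ hz
    have h3 := hb z w
    simp only [map_sub, _root_.sub_apply] at h1 h2
    have : 0 ≤ C * (‖m‖ * ‖Δ‖) ^ 2 := by positivity
    nlinarith
  -- If `w` is not critical along `V`, the equation for the derivative fails near `(w, 0)`, so the
  -- claim is vacuous there.
  · push Not at hw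
    obtain ⟨v, hv, hne⟩ := hw
    refine ⟨0, le_rfl, ?_⟩
    have hc : Continuous fun p : E × E => b p.1 v + l v - m p.2 v := by fun_prop
    have : ∀ᶠ p : E × E in 𝓝 (w, 0), b p.1 v + l v - m p.2 v ≠ 0 :=
      hc.continuousAt.eventually_ne (by simpa using hne)
    filter_upwards [this] with p hp _ hD
    exact absurd (by rw [hD v hv, sub_self]) hp

/-- Convergence of a bounded descent sequence for a quadratic function, if the derivative is
controlled by the last step along the face of the current iterate. -/
theorem exists_tendsto_of_quadratic_descent {ι : Type*} [Finite ι]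
    (b m : E →L[ℝ] E →L[ℝ] ℝ) (hb : ∀ u v, b u v = b v u) (l : E →L[ℝ] ℝ)
    (V : ι → Submodule ℝ E) (z : ℕ → E) (σ : ℕ → ι)
    (hbdd : Bornology.IsBounded (Set.range z))
    (hface : ∀ w, ∀ᶠ u in 𝓝 w, ∀ k, z k = u → u - w ∈ V (σ k))
    (hcrit : ∀ k, ∀ d ∈ V (σ (k + 1)), b (z (k + 1)) d + l d = m (z (k + 1) - z k) d)
    {c : ℝ} (hc : 0 < c)
    (hdesc : ∀ k, c * ‖z (k + 1) - z k‖ ^ 2 ≤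
      (b (z k) (z k) / 2 + l (z k)) - (b (z (k + 1)) (z (k + 1)) / 2 + l (z (k + 1)))) :
    ∃ w, Tendsto z atTop (𝓝 w) := by
  cases nonempty_fintype ι
  obtain ⟨w, -, φ, hφ, hw⟩ := tendsto_subseq_of_bounded hbdd (fun n => Set.mem_range_self n)
  refine ⟨w, ?_⟩
  set f : E → ℝ := fun u => b u u / 2 + l u with hf
  have hfc : Continuous f := by fun_prop
  have hanti : Antitone fun k => f (z k) := antitone_nat_of_succ_le fun k => by
    have := hdesc k
    have : 0 ≤ c * ‖z (k + 1) - z k‖ ^ 2 := by positivity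
    simp only [hf]
    linarith
  have hflim : Tendsto (fun k => f (z k)) atTop (𝓝 (f w)) := by
    rw [tendsto_iff_tendsto_subseq_of_antitone hanti hφ.tendsto_atTop]
    exact (hfc.tendsto w).comp hw
  have hfge : ∀ k, f w ≤ f (z k) := fun k => hanti.le_of_tendsto hflim k
  have hstep : Tendsto (fun k => z (k + 1) - z k) atTop (𝓝 0) := by
    have h1 : Tendsto (fun k => (f (z k) - f (z (k + 1))) / c) atTop (𝓝 0) := by
      simpa using (hflim.sub (hflim.comp (tendsto_add_atTop_nat 1))).div_const c
    have h2 : Tendsto (fun k => ‖z (k + 1) - z k‖ ^ 2) atTop (𝓝 0) :=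
      squeeze_zero (fun k => by positivity) (fun k => by
        rw [le_div_iff₀ hc, mul_comm]; exact hdesc k) h1
    have h3 := h2.sqrt
    simp only [Real.sqrt_zero, Real.sqrt_sq (norm_nonneg _)] at h3
    exact tendsto_zero_iff_norm_tendsto_zero.2 h3
  choose C hC0 hC using fun i => quadratic_sub_le_mul_sq b m hb l (V i) w
  have hCall := eventually_all.2 hC
  -- Summing over the finitely many faces gives one constant, whichever face the iterate lies on.
  set C' := ∑ i, C i with hC'
  have hC'0 : 0 ≤ C' := Finset.sum_nonneg fun i _ => hC0 i
  have hloc : ∀ᶠ p : E × E in 𝓝 (w, 0), ∀ k, z (k + 1) = p.1 → z (k + 1) - z k = p.2 →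
      f p.1 - f w ≤ C' * ‖p.2‖ ^ 2 := by
    have h1 : ∀ᶠ p : E × E in 𝓝 (w, 0), ∀ k, z k = p.1 → p.1 - w ∈ V (σ k) :=
      (continuous_fst.tendsto (w, (0 : E))).eventually (hface w)
    filter_upwards [hCall, h1] with p hp h1 k hk hk'
    refine (hp (σ (k + 1)) (h1 _ hk) (by rw [← hk, ← hk']; exact hcrit k)).trans ?_
    gcongr
    exact Finset.single_le_sum (fun i _ => hC0 i) (Finset.mem_univ _)
  obtain ⟨ε, hε, hball⟩ := Metric.eventually_nhds_iff.1 hloc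
  set a : ℕ → ℝ := fun k => √(f (z k) - f w)
  -- Chosen so that in the expansion of `(a (k + 1) + μ * D) ^ 2` everything beyond `a (k + 1) ^ 2`
  -- is at most `c * D ^ 2`, the guaranteed decrease.
  set μ : ℝ := min 1 (c / (2 * (C' + 1) + 1))
  have hμ0 : 0 < μ := lt_min one_pos (by positivity)
  have hμ1 : μ ≤ 1 := min_le_left _ _
  have hμ2 : (2 * (C' + 1) + 1) * μ ≤ c := by
    have : μ ≤ c / (2 * (C' + 1) + 1) := min_le_right _ _
    rwa [le_div_iff₀ (by positivity), mul_comm] at this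
  refine tendsto_of_subseq_of_dist_le hφ hw (a := a) (M := μ⁻¹) (ε := ε / 2)
    (fun k => Real.sqrt_nonneg _) ?_ (by positivity) (by positivity) ?_
  · simpa [a] using (hflim.sub_const (f w)).sqrt
  · filter_upwards [(Metric.tendsto_nhds.1 hstep) (ε / 2) (by positivity)] with k hk hkw
    rw [dist_zero_right] at hk
    set D := ‖z (k + 1) - z k‖ with hD
    have hd : dist (z k) (z (k + 1)) = D := by rw [dist_comm, dist_eq_norm]
    have hin : dist (z (k + 1), z (k + 1) - z k) (w, (0 : E)) < ε := by
      rw [Prod.dist_eq, max_lt_iff]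
      refine ⟨?_, by rw [dist_zero_right]; simp only; linarith⟩
      have := dist_triangle_left (z (k + 1)) w (z k)
      rw [hd] at this
      simp only
      linarith
    have hkl : f (z (k + 1)) - f w ≤ C' * D ^ 2 := hball hin k rfl rfl
    have hds : c * D ^ 2 ≤ f (z k) - f (z (k + 1)) := hdesc k
    have hD0 : 0 ≤ D := norm_nonneg _
    have ha1 : a (k + 1) ≤ (C' + 1) * D := by
      refine Real.sqrt_le_iff.2 ⟨by positivity, hkl.trans ?_⟩
      rw [mul_pow]
      gcongr
      nlinarith
    have hs0 : a k ^ 2 = f (z k) - f w := Real.sq_sqrt (sub_nonneg.2 (hfge k))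
    have hs1 : a (k + 1) ^ 2 = f (z (k + 1)) - f w := Real.sq_sqrt (sub_nonneg.2 (hfge (k + 1)))
    have ha0 : 0 ≤ a (k + 1) := Real.sqrt_nonneg _
    have hle : a (k + 1) + μ * D ≤ a k := by
      refine le_of_sq_le_sq ?_ (Real.sqrt_nonneg _)
      have e1 : a (k + 1) * (μ * D) ≤ (C' + 1) * D * (μ * D) := by gcongr
      have e2 : (μ * D) ^ 2 ≤ μ * D ^ 2 := by
        have : μ * (μ * D ^ 2) ≤ 1 * (μ * D ^ 2) := by gcongr
        nlinarith
      have e3 : (2 * (C' + 1) + 1) * μ * D ^ 2 ≤ c * D ^ 2 := by gcongr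
      nlinarith
    rw [hd, inv_mul_eq_div, le_div_iff₀ hμ0]
    linarith

end PSADMM

/-! ### The augmented Lagrangian and its decrease over a sweep. -/

namespace PSADMM

theorem sum_eq_sum_Iio_add_sum_Ioi {M : Type*} [AddCommMonoid M] {Q : ℕ} (f : Fin Q → M)
    (q : Fin Q) :
    ∑ i, f i = ∑ i ∈ Finset.Iio q, f i + f q + ∑ i ∈ Finset.Ioi q, f i := by
  have h : (Finset.univ : Finset (Fin Q)) = (Finset.Iio q ∪ {q}) ∪ Finset.Ioi q := by
    ext i
    simpa using le_or_gt i q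
  rw [h, Finset.sum_union, Finset.sum_union, Finset.sum_singleton]
  · simp
  · rw [Finset.disjoint_left]
    intro i hi
    simp only [Finset.mem_union, Finset.mem_Iio, Finset.mem_singleton] at hi
    simp only [Finset.mem_Ioi, not_lt]
    rcases hi with hi | rfl
    · exact hi.le
    · exact le_rfl

variable {X : Type*} [NormedAddCommGroup X] [InnerProductSpace ℝ X] {Q : ℕ}

/-- Each off-diagonal pair is counted once, with the later index inside, to match the Gauss–Seidel
sum over `i > q` in `stepForm`. -/
theorem norm_sum_sq_eq (v : Fin Q → X) :
    ‖∑ q, v q‖ ^ 2 =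
      ∑ q, ‖v q‖ ^ 2 + 2 * ∑ q, inner ℝ (v q) (∑ i ∈ Finset.Ioi q, v i) := by
  have h : ∑ q, ∑ i ∈ Finset.Iio q, inner ℝ (v q) (v i) =
      ∑ q, ∑ i ∈ Finset.Ioi q, inner ℝ (v q) (v i) := by
    rw [Finset.sum_comm' (t' := Finset.univ) (s' := fun i => Finset.Ioi i) (by simp)]
    exact Finset.sum_congr rfl fun q _ => Finset.sum_congr rfl fun i _ => real_inner_comm _ _
  rw [← real_inner_self_eq_norm_sq, sum_inner]
  simp only [inner_sum]
  rw [Finset.sum_congr rfl fun q _ => sum_eq_sum_Iio_add_sum_Ioi (fun i => inner ℝ (v q) (v i)) q]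
  simp only [Finset.sum_add_distrib, real_inner_self_eq_norm_sq, h]
  ring

section AugmentedLagrangian

open ContinuousLinearMap

noncomputable section

variable (X Q) in
/-- The space of the variables `(x, x₀, y)`. -/
abbrev State : Type _ := (Fin Q → X) × X × X

/-- The projection onto the block `x_q`. -/
def blockProj (q : Fin Q) : State X Q →L[ℝ] X := (proj q).comp (fst ℝ (Fin Q → X) (X × X))

variable (X Q) in
/-- The projection onto the consensus variable `x₀`. -/
def consensusProj : State X Q →L[ℝ] X := (fst ℝ X X).comp (snd ℝ (Fin Q → X) (X × X))

variable (X Q) in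
/-- The projection onto the multiplier `y`. -/
def multiplierProj : State X Q →L[ℝ] X := (snd ℝ X X).comp (snd ℝ (Fin Q → X) (X × X))

/-- The residual `x₀ - ∑ w_q x_q` of the consensus constraint. -/
def residual (w : Fin Q → ℝ) : State X Q →L[ℝ] X :=
  consensusProj X Q - ∑ q, w q • blockProj q

/-- The bilinear form of the quadratic part of the augmented Lagrangian. -/
def lagrangianForm (w α : Fin Q → ℝ) (ρ : ℝ) (G : X →L[ℝ] X) :
    State X Q →L[ℝ] State X Q →L[ℝ] ℝ :=
  (innerSL ℝ).bilinearComp (G.comp (consensusProj X Q)) (consensusProj X Q)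
    - ∑ q, α q • (innerSL ℝ).bilinearComp (blockProj q) (blockProj q)
    + (innerSL ℝ).bilinearComp (multiplierProj X Q) (residual w)
    + (innerSL ℝ).bilinearComp (residual w) (multiplierProj X Q)
    + ρ • (innerSL ℝ).bilinearComp (residual w) (residual w)

/-- The linear part of the augmented Lagrangian. -/
def lagrangianLinear (Q : ℕ) (h : X) : State X Q →L[ℝ] ℝ := -((innerSL ℝ h).comp (consensusProj X Q))

/-- The part of the derivative of the augmented Lagrangian at an iterate that is caused by the last
step. -/
def stepForm (w : Fin Q → ℝ) (ρ : ℝ) : State X Q →L[ℝ] State X Q →L[ℝ] ℝ :=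
  (innerSL ℝ).bilinearComp (multiplierProj X Q) (consensusProj X Q)
    + ρ⁻¹ • (innerSL ℝ).bilinearComp (multiplierProj X Q) (multiplierProj X Q)
    + ∑ q, (innerSL ℝ).bilinearComp
        (-(w q • (ρ • consensusProj X Q + multiplierProj X Q))
          + (w q * ρ) • ∑ i ∈ Finset.Ioi q, w i • blockProj i) (blockProj q)

/-- The partial gradient of the augmented Lagrangian in the block `x_q` in the middle of a sweep from
`x` to `x'`. -/
def sweepGradient (w α : Fin Q → ℝ) (ρ : ℝ) (x x' : Fin Q → X) (x₀ y : X) (q : Fin Q) : X :=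
  -(α q • x' q) - w q • (ρ • (x₀ - ∑ i, w i • x' i) + y)
    + (w q * ρ) • ∑ i ∈ Finset.Ioi q, w i • (x i - x' i)

theorem blockProj_apply (q : Fin Q) (z : State X Q) : blockProj q z = z.1 q := rfl

theorem consensusProj_apply (z : State X Q) : consensusProj X Q z = z.2.1 := rfl

theorem multiplierProj_apply (z : State X Q) : multiplierProj X Q z = z.2.2 := rfl

theorem residual_apply (w : Fin Q → ℝ) (z : State X Q) :
    residual w z = z.2.1 - ∑ q, w q • z.1 q := by
  simp [residual, blockProj_apply, consensusProj_apply, sum_apply]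

theorem lagrangianForm_apply (w α : Fin Q → ℝ) (ρ : ℝ) (G : X →L[ℝ] X) (z d : State X Q) :
    lagrangianForm w α ρ G z d = inner ℝ (G z.2.1) d.2.1 - ∑ q, α q * inner ℝ (z.1 q) (d.1 q)
      + inner ℝ z.2.2 (d.2.1 - ∑ q, w q • d.1 q) + inner ℝ (z.2.1 - ∑ q, w q • z.1 q) d.2.2
      + ρ * inner ℝ (z.2.1 - ∑ q, w q • z.1 q) (d.2.1 - ∑ q, w q • d.1 q) := by
  simp only [lagrangianForm, _root_.add_apply, _root_.sub_apply, _root_.smul_apply, sum_apply,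
    bilinearComp_apply, innerSL_apply_apply, comp_apply, residual_apply, blockProj_apply,
    consensusProj_apply, multiplierProj_apply, smul_eq_mul]

theorem lagrangianLinear_apply (h : X) (d : State X Q) :
    lagrangianLinear Q h d = -inner ℝ h d.2.1 := by
  simp [lagrangianLinear, consensusProj]

theorem stepForm_apply (w : Fin Q → ℝ) (ρ : ℝ) (z d : State X Q) :
    stepForm (X := X) w ρ z d = inner ℝ z.2.2 d.2.1 + ρ⁻¹ * inner ℝ z.2.2 d.2.2
      + ∑ q, inner ℝ (-(w q • (ρ • z.2.1 + z.2.2)) + (w q * ρ) • ∑ i ∈ Finset.Ioi q, w i • z.1 i)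
          (d.1 q) := by
  simp only [stepForm, _root_.add_apply, _root_.neg_apply, _root_.smul_apply, sum_apply,
    bilinearComp_apply, innerSL_apply_apply, blockProj_apply,
    consensusProj_apply, multiplierProj_apply, smul_eq_mul]

theorem lagrangianForm_comm (w α : Fin Q → ℝ) (ρ : ℝ) {G : X →L[ℝ] X}
    (hG : ∀ u v, inner ℝ (G u) v = inner ℝ u (G v)) (z d : State X Q) :
    lagrangianForm w α ρ G z d = lagrangianForm w α ρ G d z := by
  simp only [lagrangianForm_apply]
  rw [hG z.2.1, real_inner_comm (G d.2.1), real_inner_comm z.2.2, real_inner_comm d.2.2,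
    real_inner_comm (d.2.1 - _) (z.2.1 - _)]
  simp only [real_inner_comm (z.1 _) (d.1 _)]
  ring

/-- During the update of `x_q` the later blocks, `x₀` and `y` are still old; `stepForm` collects the
resulting discrepancy. In the `x₀` and `y` directions the derivative reduces to `y' - y` and `ρ⁻¹ •
(y' - y)`. -/
theorem lagrangianForm_add_linear_eq (w α : Fin Q → ℝ) {ρ : ℝ} (hρ : ρ ≠ 0) {G : X →L[ℝ] X} {h : X}
    {x x' : Fin Q → X} {x₀ x₀' y y' : X} (hy : y' = y + ρ • (x₀' - ∑ q, w q • x' q))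
    (hx₀ : y' = h - G x₀') (d : State X Q) :
    lagrangianForm w α ρ G (x', x₀', y') d + lagrangianLinear Q h d =
      stepForm (X := X) w ρ ((x', x₀', y') - (x, x₀, y)) d
        + ∑ q, inner ℝ (sweepGradient w α ρ x x' x₀ y q) (d.1 q) := by
  have hG : G x₀' = h - y' := by rw [hx₀]; abel
  have hR : x₀' - ∑ q, w q • x' q = ρ⁻¹ • (y' - y) := by
    rw [hy, add_sub_cancel_left, inv_smul_smul₀ hρ]
  rw [lagrangianForm_apply, lagrangianLinear_apply, stepForm_apply]
  simp only [Prod.snd_sub, Prod.fst_sub, Pi.sub_apply]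
  rw [add_assoc (_ + _) (Finset.sum _ _), ← Finset.sum_add_distrib]
  have hterm : ∀ q, inner ℝ (-(w q • (ρ • (x₀' - x₀) + (y' - y)))
        + (w q * ρ) • ∑ i ∈ Finset.Ioi q, w i • (x' i - x i)) (d.1 q)
        + inner ℝ (sweepGradient w α ρ x x' x₀ y q) (d.1 q)
      = - (α q * inner ℝ (x' q) (d.1 q)) - w q * inner ℝ (y' + (y' - y)) (d.1 q) := by
    intro q
    rw [← inner_add_left, ← real_inner_smul_left, ← real_inner_smul_left, ← inner_neg_left,
      ← inner_sub_left]
    congr 1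
    have e1 : ∑ i ∈ Finset.Ioi q, w i • (x' i - x i) = -∑ i ∈ Finset.Ioi q, w i • (x i - x' i) := by
      rw [← Finset.sum_neg_distrib]
      exact Finset.sum_congr rfl fun i _ => by rw [← smul_neg, neg_sub]
    have e2 : y' - y = ρ • (x₀' - ∑ q, w q • x' q) := by rw [hy]; abel
    rw [sweepGradient, e1, show y' + (y' - y) = y + (y' - y) + (y' - y) by abel, e2]
    module
  rw [Finset.sum_congr rfl fun q _ => hterm q]
  have hS : ∀ v : X, ∑ q, w q * inner ℝ v (d.1 q) = inner ℝ v (∑ q, w q • d.1 q) := fun v => by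
    simp only [inner_sum, real_inner_smul_right]
  rw [Finset.sum_sub_distrib, Finset.sum_neg_distrib, hS, hR, hG]
  simp only [inner_sub_left, inner_sub_right, inner_add_left, real_inner_smul_left]
  field_simp
  ring

/-- By exact Taylor expansion at the new iterate, this is the decrease of the augmented Lagrangian
over a step `d`, apart from the sweep gradient terms. The cross terms between blocks cancel, leaving
only diagonal ones. -/
theorem half_lagrangianForm_sub_stepForm (w α : Fin Q → ℝ) (ρ : ℝ) (G : X →L[ℝ] X)
    (d : State X Q) :
    lagrangianForm w α ρ G d d / 2 - stepForm (X := X) w ρ d d =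
      (∑ q, (w q ^ 2 * ρ - α q) * ‖d.1 q‖ ^ 2) / 2 + inner ℝ (G d.2.1) d.2.1 / 2
        + ρ / 2 * ‖d.2.1‖ ^ 2 - ρ⁻¹ * ‖d.2.2‖ ^ 2 := by
  rw [lagrangianForm_apply, stepForm_apply]
  have h := norm_sum_sq_eq fun q => w q • d.1 q
  set s := ∑ q, w q • d.1 q with hs
  have h1 : ∑ q, inner ℝ (-(w q • (ρ • d.2.1 + d.2.2))
        + (w q * ρ) • ∑ i ∈ Finset.Ioi q, w i • d.1 i) (d.1 q)
      = -(ρ * inner ℝ d.2.1 s + inner ℝ d.2.2 s)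
        + ρ * ∑ q, inner ℝ (w q • d.1 q) (∑ i ∈ Finset.Ioi q, w i • d.1 i) := by
    simp only [hs, inner_sum, Finset.mul_sum, ← Finset.sum_add_distrib, ← Finset.sum_neg_distrib]
    refine Finset.sum_congr rfl fun q _ => ?_
    simp only [inner_add_left, inner_neg_left, real_inner_smul_left, real_inner_smul_right,
      sum_inner, Finset.mul_sum]
    congr 1
    · ring
    · exact Finset.sum_congr rfl fun i _ => by rw [real_inner_comm (d.1 i)]; ring
  have h2 : ∑ q, (w q ^ 2 * ρ - α q) * ‖d.1 q‖ ^ 2 =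
      ρ * ∑ q, ‖w q • d.1 q‖ ^ 2 - ∑ q, α q * inner ℝ (d.1 q) (d.1 q) := by
    rw [Finset.mul_sum, ← Finset.sum_sub_distrib]
    refine Finset.sum_congr rfl fun q _ => ?_
    rw [norm_smul, mul_pow, Real.norm_eq_abs, sq_abs, real_inner_self_eq_norm_sq]
    ring
  rw [h1, h2]
  have h3 : ‖s‖ ^ 2 = inner ℝ s s := (real_inner_self_eq_norm_sq s).symm
  rw [h3] at h
  simp only [inner_sub_left, inner_sub_right, real_inner_self_eq_norm_sq] at h ⊢
  rw [real_inner_comm d.2.1 d.2.2, real_inner_comm d.2.1 s, real_inner_comm d.2.2 s]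
  linear_combination ρ / 2 * h

/-- The face of the constraint set on which the coordinates in `S` are constant, as a direction
space. -/
def faceSubmodule {J : Type*} (l : J → X →L[ℝ] ℝ) (S : Set (Fin Q × J)) :
    Submodule ℝ (State X Q) where
  carrier := {d | ∀ p ∈ S, l p.2 (d.1 p.1) = 0}
  add_mem' := fun {a b} ha hb p hp => by
    simp only [Set.mem_ofPred_eq, Prod.fst_add, Pi.add_apply, map_add] at ha hb ⊢
    rw [ha p hp, hb p hp, add_zero]
  zero_mem' := fun p _ => by simp
  smul_mem' := fun c a ha p hp => by
    simp only [Set.mem_ofPred_eq, Prod.smul_fst, Pi.smul_apply, map_smul] at ha ⊢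
    rw [ha p hp, smul_zero]

theorem mem_faceSubmodule {J : Type*} {l : J → X →L[ℝ] ℝ} {S : Set (Fin Q × J)}
    {d : State X Q} : d ∈ faceSubmodule l S ↔ ∀ p ∈ S, l p.2 (d.1 p.1) = 0 := Iff.rfl

/-- By continuity, a value `±1` can be attained arbitrarily close to `w` only if `c w` equals it.
Hence the active coordinates of a nearby iterate agree with those of the accumulation point. -/
theorem eventually_abs_eq_one_imp_eq {E : Type*} [TopologicalSpace E] {c : E → ℝ}
    (hc : Continuous c) (w : E) : ∀ᶠ u in 𝓝 w, |c u| = 1 → c u = c w := by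
  have h : ∀ s : ℝ, ∀ᶠ u in 𝓝 w, c u = s → c u = c w := fun s => by
    by_cases hs : c w = s
    · exact Eventually.of_forall fun u hu => by rw [hu, hs]
    · filter_upwards [hc.continuousAt.eventually_ne hs] with u hu hu'
      exact absurd hu' hu
  filter_upwards [h 1, h (-1)] with u h1 h2 hu
  rcases eq_or_eq_neg_of_abs_eq hu with hu | hu
  · exact h1 hu
  · exact h2 hu

/-- The augmented Lagrangian is coercive in the residual when the multiplier is the negative
gradient of the quadratic loss at `x₀`. -/
theorem le_lagrangianForm_add_linear (w α : Fin Q → ℝ) {ρ lam : ℝ} {G : X →L[ℝ] X}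
    (hG : ∀ u v, inner ℝ (G u) v = inner ℝ u (G v)) (hGn : ∀ v, ‖G v‖ ≤ lam * ‖v‖) (h : X)
    (x : Fin Q → X) (x₀ : X) :
    (inner ℝ (G (∑ q, w q • x q)) (∑ q, w q • x q) / 2 - inner ℝ h (∑ q, w q • x q)
        - (∑ q, α q * inner ℝ (x q) (x q)) / 2)
      + (ρ - lam) / 2 * ‖x₀ - ∑ q, w q • x q‖ ^ 2 ≤
      lagrangianForm w α ρ G (x, x₀, h - G x₀) (x, x₀, h - G x₀) / 2
        + lagrangianLinear Q h (x, x₀, h - G x₀) := by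
  rw [lagrangianForm_apply, lagrangianLinear_apply]
  simp only
  set s := ∑ q, w q • x q
  -- After this substitution the terms linear in `e` cancel, leaving `ρ / 2 * ‖e‖ ^ 2` minus half of
  -- `inner ℝ (G e) e`.
  obtain ⟨e, rfl⟩ : ∃ e, x₀ = s + e := ⟨x₀ - s, by abel⟩
  have h1 : inner ℝ (G e) e ≤ lam * ‖e‖ ^ 2 :=
    calc inner ℝ (G e) e ≤ ‖G e‖ * ‖e‖ := real_inner_le_norm _ _
      _ ≤ lam * ‖e‖ * ‖e‖ := by gcongr; exact hGn e
      _ = _ := by ring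
  have h2 : inner ℝ (G e) s = inner ℝ (G s) e := (hG e s).trans (real_inner_comm _ _)
  simp only [add_sub_cancel_left, map_add, inner_add_left, inner_add_right, inner_sub_left,
    inner_sub_right, real_inner_self_eq_norm_sq, real_inner_comm h e, real_inner_comm (G s) e,
    real_inner_comm (G e) e]
  nlinarith

/-- Only two properties of the block projections enter: `hvi` gives descent, and `hface` gives
criticality along the face of the new iterate. -/
theorem exists_tendsto_of_sweep_descent [FiniteDimensional ℝ X] {J : Type*} [Finite J]
    {w α : Fin Q → ℝ} {ρ lam : ℝ} {G : X →L[ℝ] X}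
    (hG : ∀ u v, inner ℝ (G u) v = inner ℝ u (G v)) (hGpos : ∀ v, 0 ≤ inner ℝ (G v) v)
    (hGn : ∀ v, ‖G v‖ ≤ lam * ‖v‖) (hlam : 0 ≤ lam) (hρ : √2 * lam < ρ)
    (hα : ∀ q, α q < w q ^ 2 * ρ) (h : X) (l : J → X →L[ℝ] ℝ)
    {K : Set (Fin Q → X)} (hK : IsCompact K) {x : ℕ → Fin Q → X} {x₀ y : ℕ → X}
    (hxK : ∀ k, x k ∈ K)
    (hvi : ∀ k q, 0 ≤ inner ℝ (sweepGradient w α ρ (x k) (x (k + 1)) (x₀ k) (y k) q)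
      (x k q - x (k + 1) q))
    (hface : ∀ k q d, (∀ j, |l j (x (k + 1) q)| = 1 → l j d = 0) →
      inner ℝ (sweepGradient w α ρ (x k) (x (k + 1)) (x₀ k) (y k) q) d = 0)
    (hyG : ∀ k, y k = h - G (x₀ k))
    (hy : ∀ k, y (k + 1) = y k + ρ • (x₀ (k + 1) - ∑ q, w q • x (k + 1) q)) :
    ∃ z : State X Q, Tendsto (fun k => (x k, x₀ k, y k)) atTop (𝓝 z) := by
  have hsqrt : 1 ≤ √2 := by rw [Real.one_le_sqrt]; norm_num
  have hρ0 : 0 < ρ := lt_of_le_of_lt (by positivity) hρ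
  have hlamρ : lam < ρ := lt_of_le_of_lt (by nlinarith) hρ
  -- This is where the factor `√2` is needed: positivity amounts to `2 * lam ^ 2 < ρ ^ 2`.
  have hgap : 0 < ρ / 2 - ρ⁻¹ * lam ^ 2 := by
    have h1 : (√2 * lam) ^ 2 < ρ ^ 2 := by gcongr
    rw [mul_pow, Real.sq_sqrt (by norm_num)] at h1
    have h2 : ρ / 2 - ρ⁻¹ * lam ^ 2 = (ρ ^ 2 - 2 * lam ^ 2) / (2 * ρ) := by
      field_simp
    rw [h2]
    exact div_pos (by linarith) (by positivity)
  set z : ℕ → State X Q := fun k => (x k, x₀ k, y k) with hz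
  set b := lagrangianForm w α ρ G
  set m := stepForm (X := X) w ρ
  set L := lagrangianLinear Q h
  have hcrit : ∀ k d, b (z (k + 1)) d + L d = m (z (k + 1) - z k) d
      + ∑ q, inner ℝ (sweepGradient w α ρ (x k) (x (k + 1)) (x₀ k) (y k) q) (d.1 q) :=
    fun k d => lagrangianForm_add_linear_eq w α hρ0.ne' (hy k) (hyG (k + 1)) d
  have hbs : ∀ u v, b u v = b v u := lagrangianForm_comm w α ρ hG
  have hdec : ∀ k, (∑ q, (w q ^ 2 * ρ - α q) * ‖x (k + 1) q - x k q‖ ^ 2) / 2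
      + (ρ / 2 - ρ⁻¹ * lam ^ 2) * ‖x₀ (k + 1) - x₀ k‖ ^ 2 ≤
      (b (z k) (z k) / 2 + L (z k)) - (b (z (k + 1)) (z (k + 1)) / 2 + L (z (k + 1))) := fun k => by
    have e1 := hcrit k (z k - z (k + 1))
    have e2 : 0 ≤ ∑ q, inner ℝ (sweepGradient w α ρ (x k) (x (k + 1)) (x₀ k) (y k) q)
        ((z k - z (k + 1)).1 q) := Finset.sum_nonneg fun q _ => hvi k q
    have e3 := half_lagrangianForm_sub_stepForm w α ρ G (z (k + 1) - z k)
    have e4 := hGpos (x₀ (k + 1) - x₀ k)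
    have e5 : ‖y (k + 1) - y k‖ ^ 2 ≤ lam ^ 2 * ‖x₀ (k + 1) - x₀ k‖ ^ 2 := by
      rw [← mul_pow]
      gcongr
      have : y (k + 1) - y k = -G (x₀ (k + 1) - x₀ k) := by
        rw [hyG, hyG, map_sub]; abel
      rw [this, norm_neg]
      exact hGn _
    have e6 : ρ⁻¹ * ‖y (k + 1) - y k‖ ^ 2 ≤ ρ⁻¹ * (lam ^ 2 * ‖x₀ (k + 1) - x₀ k‖ ^ 2) := by
      gcongr
    have e7 := hbs (z k) (z (k + 1))
    have e8 : m (z (k + 1) - z k) (z k - z (k + 1)) =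
        -m (z (k + 1) - z k) (z (k + 1) - z k) := by
      rw [← map_neg, neg_sub]
    rw [e8] at e1
    change b (z (k + 1) - z k) (z (k + 1) - z k) / 2 - m (z (k + 1) - z k) (z (k + 1) - z k) =
      (∑ q, (w q ^ 2 * ρ - α q) * ‖x (k + 1) q - x k q‖ ^ 2) / 2
        + inner ℝ (G (x₀ (k + 1) - x₀ k)) (x₀ (k + 1) - x₀ k) / 2
        + ρ / 2 * ‖x₀ (k + 1) - x₀ k‖ ^ 2 - ρ⁻¹ * ‖y (k + 1) - y k‖ ^ 2 at e3
    have e9 : b (z (k + 1) - z k) (z (k + 1) - z k) =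
        b (z (k + 1)) (z (k + 1)) - 2 * b (z (k + 1)) (z k) + b (z k) (z k) := by
      simp only [map_sub, _root_.sub_apply]
      linarith
    rw [map_sub (b (z (k + 1))), map_sub L] at e1
    linarith
  have hterm : ∀ k q, 0 ≤ (w q ^ 2 * ρ - α q) * ‖x (k + 1) q - x k q‖ ^ 2 := fun k q =>
    mul_nonneg (sub_nonneg.2 (hα q).le) (by positivity)
  have hanti : Antitone fun k => b (z k) (z k) / 2 + L (z k) := antitone_nat_of_succ_le fun k => by
    have h1 := hdec k
    have h2 := Finset.sum_nonneg fun q (_ : q ∈ Finset.univ) => hterm k q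
    have h3 : 0 ≤ (ρ / 2 - ρ⁻¹ * lam ^ 2) * ‖x₀ (k + 1) - x₀ k‖ ^ 2 := by positivity
    linarith
  -- boundedness of the iterates
  have hbdd : Bornology.IsBounded (Set.range z) := by
    have hψ : Continuous fun v : Fin Q → X => inner ℝ (G (∑ q, w q • v q)) (∑ q, w q • v q) / 2
        - inner ℝ h (∑ q, w q • v q) - (∑ q, α q * inner ℝ (v q) (v q)) / 2 := by fun_prop
    obtain ⟨B, hB⟩ := hK.bddBelow_image hψ.continuousOn
    set R := √(2 * (b (z 0) (z 0) / 2 + L (z 0) - B) / (ρ - lam))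
    have hR : ∀ k, ‖x₀ k - ∑ q, w q • x k q‖ ≤ R := fun k => by
      refine Real.le_sqrt_of_sq_le ?_
      have h1 := hB (Set.mem_image_of_mem _ (hxK k))
      have h2 := le_lagrangianForm_add_linear w α (ρ := ρ) hG hGn h (x k) (x₀ k)
      rw [← hyG k] at h2
      have h3 : b (z k) (z k) / 2 + L (z k) ≤ b (z 0) (z 0) / 2 + L (z 0) := hanti (Nat.zero_le k)
      rw [le_div_iff₀ (by linarith)]
      change _ ≤ b (z k) (z k) / 2 + L (z k) at h2
      linarith
    -- Since `y` is a function of `x₀`, the state is a continuous function of `x` and the residual,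
    -- both confined to compact sets.
    have hΨ : Continuous fun p : (Fin Q → X) × X =>
        ((p.1, p.2 + ∑ q, w q • p.1 q, h - G (p.2 + ∑ q, w q • p.1 q)) : State X Q) := by fun_prop
    refine ((hK.prod (isCompact_closedBall (0 : X) R)).image hΨ).isBounded.subset ?_
    rintro _ ⟨k, rfl⟩
    refine ⟨(x k, x₀ k - ∑ q, w q • x k q), ⟨hxK k, by simpa using hR k⟩, ?_⟩
    simp only [sub_add_cancel, hz, hyG k]
  -- a uniform descent constant
  obtain ⟨c, hc0, hcq, hc1, hc2⟩ : ∃ c : ℝ, 0 < c ∧ (∀ q, c ≤ (w q ^ 2 * ρ - α q) / 2) ∧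
      c ≤ ρ / 2 - ρ⁻¹ * lam ^ 2 ∧ c * lam ^ 2 ≤ ρ / 2 - ρ⁻¹ * lam ^ 2 := by
    have h1 : ∀ᶠ c : ℝ in 𝓝[>] 0, ∀ q, c ≤ (w q ^ 2 * ρ - α q) / 2 := by
      rw [eventually_all]
      exact fun q => nhdsWithin_le_nhds
        ((gt_mem_nhds (half_pos (sub_pos.2 (hα q)))).mono fun _ h => le_of_lt h)
    have h2 : ∀ᶠ c : ℝ in 𝓝[>] 0, c ≤ ρ / 2 - ρ⁻¹ * lam ^ 2 :=
      nhdsWithin_le_nhds ((gt_mem_nhds hgap).mono fun _ h => le_of_lt h)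
    have h3 : ∀ᶠ c : ℝ in 𝓝[>] 0, c * lam ^ 2 ≤ ρ / 2 - ρ⁻¹ * lam ^ 2 := by
      have : Tendsto (fun c : ℝ => c * lam ^ 2) (𝓝 0) (𝓝 0) := by
        simpa using (continuous_mul_const (lam ^ 2)).tendsto (0 : ℝ)
      exact nhdsWithin_le_nhds ((this.eventually (gt_mem_nhds hgap)).mono fun _ h => le_of_lt h)
    obtain ⟨c, ⟨⟨hc1, hc2⟩, hc3⟩, hc4⟩ :=
      (((h1.and h2).and h3).and (eventually_mem_nhdsWithin)).exists
    exact ⟨c, hc4, hc1, hc2, hc3⟩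
  refine exists_tendsto_of_quadratic_descent b m hbs L (faceSubmodule l) z
    (fun k => {p : Fin Q × J | |l p.2 (x k p.1)| = 1}) hbdd ?_ ?_ hc0 ?_
  · intro u
    have h1 : ∀ᶠ v in 𝓝 u, ∀ p : Fin Q × J,
        |l p.2 (blockProj p.1 v)| = 1 → l p.2 (blockProj p.1 v) = l p.2 (blockProj p.1 u) :=
      eventually_all.2 fun p => eventually_abs_eq_one_imp_eq (by fun_prop) u
    filter_upwards [h1] with v hv k hk p hp
    have := hv p (by rw [← hk]; exact hp)
    change l p.2 (blockProj p.1 (v - u)) = 0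
    rw [map_sub, map_sub, this, sub_self]
  · intro k d hd
    rw [hcrit k d, Finset.sum_eq_zero, add_zero]
    exact fun q _ => hface k q _ fun j hj => hd (q, j) hj
  · intro k
    refine le_trans ?_ (hdec k)
    set D := (∑ q, (w q ^ 2 * ρ - α q) * ‖x (k + 1) q - x k q‖ ^ 2) / 2
      + (ρ / 2 - ρ⁻¹ * lam ^ 2) * ‖x₀ (k + 1) - x₀ k‖ ^ 2 with hD
    have hs := Finset.sum_nonneg fun q (_ : q ∈ Finset.univ) => hterm k q
    have h0 : 0 ≤ (ρ / 2 - ρ⁻¹ * lam ^ 2) * ‖x₀ (k + 1) - x₀ k‖ ^ 2 := by positivity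
    have key : ∀ t : ℝ, c * t ^ 2 ≤ D → t ≤ √(D / c) := fun t ht =>
      Real.le_sqrt_of_sq_le (by rw [le_div_iff₀ hc0]; linarith)
    have hx : ‖z (k + 1) - z k‖ ≤ √(D / c) := by
      -- The state space carries the sup norm, so each component can be bounded separately.
      rw [norm_prod_le_iff, norm_prod_le_iff]
      refine ⟨(pi_norm_le_iff_of_nonneg (Real.sqrt_nonneg _)).2 fun q => key _ ?_, key _ ?_,
        key _ ?_⟩
      · change c * ‖x (k + 1) q - x k q‖ ^ 2 ≤ D
        have h1 := Finset.single_le_sum (fun q _ => hterm k q) (Finset.mem_univ q)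
        have h2 : c * ‖x (k + 1) q - x k q‖ ^ 2 ≤
            (w q ^ 2 * ρ - α q) / 2 * ‖x (k + 1) q - x k q‖ ^ 2 := by
          gcongr
          exact hcq q
        linarith
      · change c * ‖x₀ (k + 1) - x₀ k‖ ^ 2 ≤ D
        have h2 : c * ‖x₀ (k + 1) - x₀ k‖ ^ 2 ≤
            (ρ / 2 - ρ⁻¹ * lam ^ 2) * ‖x₀ (k + 1) - x₀ k‖ ^ 2 := by gcongr
        linarith
      · change c * ‖y (k + 1) - y k‖ ^ 2 ≤ D
        have h1 : ‖y (k + 1) - y k‖ ≤ lam * ‖x₀ (k + 1) - x₀ k‖ := by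
          have : y (k + 1) - y k = -G (x₀ (k + 1) - x₀ k) := by
            rw [hyG, hyG, map_sub]; abel
          rw [this, norm_neg]
          exact hGn _
        have h2 : c * ‖y (k + 1) - y k‖ ^ 2 ≤ c * (lam * ‖x₀ (k + 1) - x₀ k‖) ^ 2 := by gcongr
        have h3 : c * lam ^ 2 * ‖x₀ (k + 1) - x₀ k‖ ^ 2 ≤
            (ρ / 2 - ρ⁻¹ * lam ^ 2) * ‖x₀ (k + 1) - x₀ k‖ ^ 2 := by gcongr
        rw [mul_pow, ← mul_assoc] at h2
        linarith
    have hD0 : 0 ≤ D := by linarith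
    calc c * ‖z (k + 1) - z k‖ ^ 2 ≤ c * √(D / c) ^ 2 := by gcongr
      _ = D := by rw [Real.sq_sqrt (by positivity)]; field_simp

end

end AugmentedLagrangian

end PSADMM

namespace PSADMM

theorem real_inner_eq_sum {n : ℕ} (u v : CVec n) :
    inner ℝ u v = ∑ i, ((u i).re * (v i).re + (u i).im * (v i).im) := by
  rw [PiLp.inner_apply]
  refine Finset.sum_congr rfl fun i _ => ?_
  rw [Complex.inner, Complex.mul_re, Complex.conj_re, Complex.conj_im]
  ring

theorem re_inner_eq_real_inner {n : ℕ} (u v : CVec n) : (inner ℂ u v).re = inner ℝ u v := by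
  rw [PiLp.inner_apply, PiLp.inner_apply, Complex.re_sum]
  rfl

/-! ### The box and its projection. -/

section Box

theorem clip_mem_Icc (t : ℝ) : clip t ∈ Set.Icc (-1 : ℝ) 1 :=
  ⟨le_max_left _ _, max_le (by norm_num) (min_le_left _ _)⟩

theorem clip_sub_mul_sub_nonneg (t : ℝ) {s : ℝ} (hs : s ∈ Set.Icc (-1 : ℝ) 1) :
    0 ≤ (clip t - t) * (s - clip t) := by
  obtain ⟨h1, h2⟩ := hs
  unfold clip
  rcases le_total 1 t with h | h
  · rw [min_eq_left h, max_eq_right (by norm_num)]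
    nlinarith
  · rw [min_eq_right h]
    rcases le_total (-1) t with h' | h'
    · rw [max_eq_right h']; simp
    · rw [max_eq_left h']
      nlinarith

theorem clip_eq_self {t : ℝ} (h : |clip t| ≠ 1) : clip t = t := by
  unfold clip at *
  rcases le_total 1 t with h1 | h1
  · rw [min_eq_left h1, max_eq_right (by norm_num)] at h
    simp at h
  · rw [min_eq_right h1] at h ⊢
    rcases le_total (-1) t with h' | h'
    · exact max_eq_right h'
    · rw [max_eq_left h'] at h
      simp at h

theorem boxProj_mem_box {U : ℕ} (v : CVec U) : boxProj v ∈ box U :=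
  fun _ => ⟨clip_mem_Icc _, clip_mem_Icc _⟩

theorem inner_boxProj_sub_nonneg {U : ℕ} (p : CVec U) {v : CVec U} (hv : v ∈ box U) :
    0 ≤ inner ℝ (boxProj p - p) (v - boxProj p) := by
  rw [real_inner_eq_sum]
  exact Finset.sum_nonneg fun i _ => add_nonneg
    (clip_sub_mul_sub_nonneg _ (hv i).1) (clip_sub_mul_sub_nonneg _ (hv i).2)

/-- The real coordinates of a complex vector. -/
noncomputable def coord (U : ℕ) : Fin U ⊕ Fin U → CVec U →L[ℝ] ℝ
  | .inl i => Complex.reCLM.comp (PiLp.proj 2 (fun _ : Fin U => ℂ) i : CVec U →L[ℝ] ℂ)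
  | .inr i => Complex.imCLM.comp (PiLp.proj 2 (fun _ : Fin U => ℂ) i : CVec U →L[ℝ] ℂ)

/-- In each real coordinate either the projection leaves `p` unchanged, or it lands at `±1` and `d`
vanishes there. -/
theorem inner_boxProj_sub_eq_zero {U : ℕ} (p : CVec U) {d : CVec U}
    (hd : ∀ j, |coord U j (boxProj p)| = 1 → coord U j d = 0) :
    inner ℝ (boxProj p - p) d = 0 := by
  rw [real_inner_eq_sum]
  refine Finset.sum_eq_zero fun i _ => ?_
  have h : ∀ t s : ℝ, (|clip t| = 1 → s = 0) → (clip t - t) * s = 0 := fun t s hts => by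
    by_cases h1 : |clip t| = 1
    · rw [hts h1, mul_zero]
    · rw [clip_eq_self h1, sub_self, zero_mul]
  have h1 := h (p i).re (d i).re (hd (.inl i))
  have h2 := h (p i).im (d i).im (hd (.inr i))
  change (clip (p i).re - (p i).re) * (d i).re + (clip (p i).im - (p i).im) * (d i).im = 0
  rw [h1, h2, add_zero]

theorem isClosed_box (U : ℕ) : IsClosed (box U) := by
  have h : box U = ⋂ i, ((fun v : CVec U => (v i).re) ⁻¹' Set.Icc (-1 : ℝ) 1 ∩
      (fun v : CVec U => (v i).im) ⁻¹' Set.Icc (-1 : ℝ) 1) := by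
    ext v
    simp only [Set.mem_iInter]
    rfl
  rw [h]
  exact isClosed_iInter fun i => (isClosed_Icc.preimage (by fun_prop)).inter
    (isClosed_Icc.preimage (by fun_prop))

theorem isCompact_box (U : ℕ) : IsCompact (box U) := by
  refine Metric.isCompact_of_isClosed_isBounded (isClosed_box U) ?_
  refine (Metric.isBounded_closedBall (x := (0 : CVec U)) (r := √(∑ _i : Fin U, 2))).subset
    fun v hv => ?_
  rw [mem_closedBall_zero_iff]
  refine Real.le_sqrt_of_sq_le ?_
  rw [← real_inner_self_eq_norm_sq, real_inner_eq_sum]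
  refine Finset.sum_le_sum fun i _ => ?_
  obtain ⟨⟨h1, h2⟩, h3, h4⟩ := hv i
  nlinarith

end Box

/-! ### The Gram operator and the `x₀`-update. -/

section Gram

open scoped ComplexOrder

variable {B U : ℕ} (H : Matrix (Fin B) (Fin U) ℂ)

/-- The Gram operator `v ↦ Hᴴ H v` as a real linear map. -/
noncomputable def gram : CVec U →L[ℝ] CVec U :=
  LinearMap.toContinuousLinearMap ((Matrix.toEuclideanLin (Hᴴ * H)).restrictScalars ℝ)

theorem gram_apply (v : CVec U) : gram H v = Matrix.toEuclideanLin (Hᴴ * H) v := rfl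

theorem gram_eq (v : CVec U) :
    gram H v = Matrix.toEuclideanLin Hᴴ (Matrix.toEuclideanLin H v) := by
  rw [gram_apply]
  simp [Matrix.toLpLin_apply, Matrix.mulVec_mulVec]

theorem real_inner_toEuclideanLin_conjTranspose (u : CVec B) (v : CVec U) :
    inner ℝ (Matrix.toEuclideanLin Hᴴ u) v = inner ℝ u (Matrix.toEuclideanLin H v) := by
  rw [← re_inner_eq_real_inner, ← re_inner_eq_real_inner,
    Matrix.toEuclideanLin_conjTranspose_eq_adjoint, LinearMap.adjoint_inner_left]

theorem inner_gram_left (u v : CVec U) : inner ℝ (gram H u) v =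
    inner ℝ (Matrix.toEuclideanLin H u) (Matrix.toEuclideanLin H v) := by
  rw [gram_eq, real_inner_toEuclideanLin_conjTranspose]

theorem inner_gram_comm (u v : CVec U) : inner ℝ (gram H u) v = inner ℝ u (gram H v) := by
  rw [real_inner_comm (gram H v), inner_gram_left, inner_gram_left, real_inner_comm]

theorem inner_gram_self_nonneg (v : CVec U) : 0 ≤ inner ℝ (gram H v) v := by
  rw [inner_gram_left]
  exact real_inner_self_nonneg

theorem lamMax_nonneg : 0 ≤ lamMax H :=
  Real.iSup_nonneg fun i => (Matrix.posSemidef_conjTranspose_mul_self H).eigenvalues_nonneg i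

/-- Parseval in an orthonormal eigenbasis, where the operator multiplies each coefficient by an
eigenvalue in `[0, lamMax H]`. -/
theorem norm_gram_le (v : CVec U) : ‖gram H v‖ ≤ lamMax H * ‖v‖ := by
  set hA := Matrix.isHermitian_conjTranspose_mul_self H
  refine le_of_sq_le_sq ?_ (mul_nonneg (lamMax_nonneg H) (norm_nonneg _))
  rw [mul_pow, ← hA.eigenvectorBasis.sum_sq_norm_inner_right (gram H v),
    ← hA.eigenvectorBasis.sum_sq_norm_inner_right v, Finset.mul_sum]
  refine Finset.sum_le_sum fun i _ => ?_
  have h1 : Matrix.toEuclideanLin (Hᴴ * H) (hA.eigenvectorBasis i) =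
      (hA.eigenvalues i : ℂ) • hA.eigenvectorBasis i := by
    rw [Matrix.toLpLin_apply, hA.mulVec_eigenvectorBasis i]
    ext j
    simp
  have h2 : inner ℂ (hA.eigenvectorBasis i) (gram H v) =
      (hA.eigenvalues i : ℂ) * inner ℂ (hA.eigenvectorBasis i) v := by
    have hs := (Matrix.isSymmetric_toEuclideanLin_iff.mpr hA) (hA.eigenvectorBasis i) v
    rw [gram_apply, ← hs, h1, inner_smul_left, Complex.conj_ofReal]
  have h3 : 0 ≤ hA.eigenvalues i :=
    (Matrix.posSemidef_conjTranspose_mul_self H).eigenvalues_nonneg i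
  have h4 : hA.eigenvalues i ≤ lamMax H :=
    le_ciSup (f := fun i => hA.eigenvalues i) (Set.finite_range _).bddAbove i
  rw [h2, norm_mul, mul_pow, Complex.norm_real, Real.norm_of_nonneg h3]
  gcongr

theorem isUnit_gram_add_smul_one {ρ : ℝ} (hρ : 0 < ρ) :
    IsUnit (Hᴴ * H + (ρ : ℂ) • (1 : Matrix (Fin U) (Fin U) ℂ)) := by
  refine Matrix.PosDef.isUnit ?_
  exact Matrix.PosDef.posSemidef_add (Matrix.posSemidef_conjTranspose_mul_self H)
    (Matrix.PosDef.one.smul (by exact_mod_cast hρ))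

theorem gram_add_smul_of_eq_inv {ρ : ℝ} (hρ : 0 < ρ) {u v : CVec U}
    (h : u = Matrix.toEuclideanLin ((Hᴴ * H + (ρ : ℂ) • (1 : Matrix (Fin U) (Fin U) ℂ))⁻¹) v) :
    gram H u + ρ • u = v := by
  set A := Hᴴ * H + (ρ : ℂ) • (1 : Matrix (Fin U) (Fin U) ℂ) with hA
  have hdet : IsUnit A.det := (Matrix.isUnit_iff_isUnit_det A).1 (isUnit_gram_add_smul_one H hρ)
  have h1 : Matrix.toEuclideanLin A u = v := by
    rw [h]
    rw [Matrix.toLpLin_apply, Matrix.toLpLin_apply, WithLp.ofLp_toLp, Matrix.mulVec_mulVec,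
      Matrix.mul_nonsing_inv A hdet, Matrix.one_mulVec]
  rw [← h1, hA, map_add, map_smul, LinearMap.add_apply, LinearMap.smul_apply, ← gram_apply]
  congr 1
  ext j
  simp

end Gram

/-! ### Partial gradients of the objective. -/

section Gradient

variable {B U Q : ℕ}

theorem wsum_update (x : Fin Q → CVec U) (q : Fin Q) (z : CVec U) :
    wsum (Function.update x q z) = wsum x + (2 : ℝ) ^ (q : ℕ) • (z - x q) := by
  have h : ∀ i : Fin Q, (2 : ℝ) ^ (i : ℕ) • Function.update x q z i =
      (2 : ℝ) ^ (i : ℕ) • x i + if i = q then (2 : ℝ) ^ (q : ℕ) • (z - x q) else 0 := fun i => by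
    by_cases hi : i = q
    · subst hi
      simp [smul_sub]
    · simp [hi]
  simp only [wsum, h, Finset.sum_add_distrib, Finset.sum_ite_eq', Finset.mem_univ, if_true]

theorem blockGradient_eq (H : Matrix (Fin B) (Fin U) ℂ) (r : CVec B) (α : Fin Q → ℝ)
    (x : Fin Q → CVec U) (q : Fin Q) :
    blockGradient H r α x q =
      -(α q • x q) - (2 : ℝ) ^ (q : ℕ) • (Matrix.toEuclideanLin Hᴴ r - gram H (wsum x)) := by
  refine HasGradientAt.gradient ?_
  let T : CVec U →L[ℝ] CVec B :=
    LinearMap.toContinuousLinearMap ((Matrix.toEuclideanLin H).restrictScalars ℝ)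
  have hT : ∀ v, T v = Matrix.toEuclideanLin H v := fun _ => rfl
  have hf : (fun z : CVec U => objective H r α (Function.update x q z)) = fun z =>
      1 / 2 * ‖r - T (wsum x + (2 : ℝ) ^ (q : ℕ) • (z - x q))‖ ^ 2 -
        (α q / 2 * ‖z‖ ^ 2 + ∑ i ∈ Finset.univ.erase q, α i / 2 * ‖x i‖ ^ 2) := by
    funext z
    rw [objective, loss, wsum_update, ← hT, ← Finset.add_sum_erase _ _ (Finset.mem_univ q)]
    congr 2
    · simp
    · refine Finset.sum_congr rfl fun i hi => ?_
      rw [Function.update_of_ne (Finset.ne_of_mem_erase hi)]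
  rw [hasGradientAt_iff_hasFDerivAt, hf]
  have h1 : HasFDerivAt (fun z : CVec U => r - T (wsum x + (2 : ℝ) ^ (q : ℕ) • (z - x q)))
      (-(T.comp ((2 : ℝ) ^ (q : ℕ) • ContinuousLinearMap.id ℝ (CVec U)))) (x q) := by
    have := (((hasFDerivAt_id (𝕜 := ℝ) (x q)).sub_const (x q)).const_smul
      ((2 : ℝ) ^ (q : ℕ))).const_add (wsum x)
    exact (T.hasFDerivAt.comp (x q) this).const_sub r
  have h2 := (h1.norm_sq.const_mul (1 / 2)).sub
    ((((hasFDerivAt_id (𝕜 := ℝ) (x q)).norm_sq).const_mul (α q / 2)).add_const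
      (∑ i ∈ Finset.univ.erase q, α i / 2 * ‖x i‖ ^ 2))
  refine h2.congr_fderiv ?_
  ext v
  have h3 : inner ℝ (Matrix.toEuclideanLin Hᴴ r - gram H (wsum x)) v =
      inner ℝ (r - T (wsum x)) (T v) := by
    rw [inner_sub_left, inner_sub_left, inner_gram_left,
      real_inner_toEuclideanLin_conjTranspose]
    rfl
  simp only [InnerProductSpace.toDual_apply_apply]
  rw [inner_sub_left, inner_neg_left, real_inner_smul_left, real_inner_smul_left, h3]
  simp [inner_sub_left]
  ring

end Gradient

/-- In each block, the update of `x_q` is a scaled projection step along the gradient of the augmented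
Lagrangian. -/
theorem sweepGradient_eq_smul {U Q : ℕ} {α : Fin Q → ℝ} {ρ : ℝ} {q : Fin Q}
    (hc : α q < 4 ^ (q : ℕ) * ρ) (x x' : Fin Q → CVec U) (x₀ y : CVec U) :
    sweepGradient (fun q : Fin Q => (2 : ℝ) ^ (q : ℕ)) α ρ x x' x₀ y q =
      (4 ^ (q : ℕ) * ρ - α q) • (x' q - ((2 : ℝ) ^ (q : ℕ) / (4 ^ (q : ℕ) * ρ - α q)) •
      (ρ • x₀ - ρ • (∑ i ∈ Finset.Iio q, (2 : ℝ) ^ (i : ℕ) • x' i)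
        - ρ • (∑ i ∈ Finset.Ioi q, (2 : ℝ) ^ (i : ℕ) • x i) + y)) := by
  have hne : 4 ^ (q : ℕ) * ρ - α q ≠ 0 := (sub_pos.2 hc).ne'
  have h4 : (4 : ℝ) ^ (q : ℕ) = 2 ^ (q : ℕ) * 2 ^ (q : ℕ) := by rw [← mul_pow]; norm_num
  rw [smul_sub, smul_smul, mul_div_cancel₀ _ hne, sweepGradient,
    sum_eq_sum_Iio_add_sum_Ioi (fun i => (2 : ℝ) ^ (i : ℕ) • x' i) q, h4]
  simp only [smul_sub, Finset.sum_sub_distrib]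
  module

end PSADMM

/-! ### Convergence and stationarity of the limit. -/

theorem theorem1 {B U Q : ℕ} (H : Matrix (Fin B) (Fin U) ℂ) (r : PSADMM.CVec B)
    (ρ : ℝ) (α : Fin Q → ℝ) (hα : ∀ q, 0 ≤ α q)
    (hρα : ∀ q : Fin Q, α q < 4 ^ (q : ℕ) * ρ)
    (hρ : Real.sqrt 2 * PSADMM.lamMax H < ρ)
    (x : ℕ → Fin Q → PSADMM.CVec U) (x₀ y : ℕ → PSADMM.CVec U)
    (hiter : PSADMM.IsPSADMM H r ρ α x x₀ y) :
    ∃ (xs : Fin Q → PSADMM.CVec U) (x₀s ys : PSADMM.CVec U),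
      (∀ q, Tendsto (fun k => x k q) atTop (𝓝 (xs q))) ∧
      Tendsto x₀ atTop (𝓝 x₀s) ∧
      Tendsto y atTop (𝓝 ys) ∧
      x₀s = PSADMM.wsum xs ∧
      PSADMM.IsStationaryPoint H r α xs := by
  open PSADMM in
  set w : Fin Q → ℝ := fun q => (2 : ℝ) ^ (q : ℕ) with hw
  set h : CVec U := Matrix.toEuclideanLin Hᴴ r with hh
  have hρ0 : 0 < ρ := lt_of_le_of_lt (mul_nonneg (by positivity) (lamMax_nonneg H)) hρ
  have hxbox : ∀ k q, x (k + 1) q ∈ box U := fun k q => by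
    rw [hiter.x_update]
    exact boxProj_mem_box _
  have hvi : ∀ k q, ∀ v ∈ box U,
      0 ≤ inner ℝ (sweepGradient w α ρ (x k) (x (k + 1)) (x₀ k) (y k) q) (v - x (k + 1) q) := by
    intro k q v hv
    rw [sweepGradient_eq_smul (hρα q), real_inner_smul_left]
    refine mul_nonneg (sub_pos.2 (hρα q)).le ?_
    rw [hiter.x_update k q]
    exact inner_boxProj_sub_nonneg _ hv
  have hface : ∀ k q d, (∀ j, |coord U j (x (k + 1) q)| = 1 → coord U j d = 0) →
      inner ℝ (sweepGradient w α ρ (x k) (x (k + 1)) (x₀ k) (y k) q) d = 0 := by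
    intro k q d hd
    rw [sweepGradient_eq_smul (hρα q), real_inner_smul_left]
    rw [hiter.x_update k q] at hd ⊢
    rw [inner_boxProj_sub_eq_zero _ hd, mul_zero]
  -- The `x₀`-update solves `gram H x₀ + ρ • x₀ = h + ρ • wsum x - y`; the multiplier step then
  -- turns this into the claimed relation.
  have hyG : ∀ k, y (k + 1) = h - gram H (x₀ (k + 1)) := fun k => by
    have h1 := gram_add_smul_of_eq_inv H hρ0 (hiter.x₀_update k)
    have h2 : gram H (x₀ (k + 1)) = h + ρ • wsum (x (k + 1)) - y k - ρ • x₀ (k + 1) := by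
      rw [← h1]; abel
    rw [hiter.y_update, h2, smul_sub]
    abel
  -- The sequences are shifted by one, because the arbitrary initial data need neither lie in the
  -- box nor satisfy the relation `hyG`.
  obtain ⟨⟨xs, x₀s, ys⟩, hz⟩ := exists_tendsto_of_sweep_descent (w := w) (α := α) (ρ := ρ)
    (inner_gram_comm H) (inner_gram_self_nonneg H) (norm_gram_le H) (lamMax_nonneg H) hρ
    (fun q => by
      have : (w q) ^ 2 = 4 ^ (q : ℕ) := by simp only [hw]; rw [← pow_mul, mul_comm, pow_mul]; norm_num
      rw [this]; exact hρα q)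
    h (coord U) (isCompact_univ_pi fun _ : Fin Q => isCompact_box U)
    (x := fun k => x (k + 1)) (x₀ := fun k => x₀ (k + 1)) (y := fun k => y (k + 1))
    (fun k q _ => hxbox k q) (fun k q => hvi (k + 1) q _ (hxbox k q))
    (fun k q d => hface (k + 1) q d) hyG (fun k => hiter.y_update (k + 1))
  have hx' : ∀ q, Tendsto (fun k => x k q) atTop (𝓝 (xs q)) := fun q =>
    (tendsto_add_atTop_iff_nat 1).1
      (((continuous_apply q).comp continuous_fst).tendsto _ |>.comp hz)
  have hx₀' : Tendsto x₀ atTop (𝓝 x₀s) := (tendsto_add_atTop_iff_nat 1).1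
    ((continuous_fst.comp continuous_snd).tendsto _ |>.comp hz)
  have hy' : Tendsto y atTop (𝓝 ys) := (tendsto_add_atTop_iff_nat 1).1
    ((continuous_snd.comp continuous_snd).tendsto _ |>.comp hz)
  have hws : Tendsto (fun k => wsum (x k)) atTop (𝓝 (wsum xs)) :=
    tendsto_finsetSum _ fun q _ => (hx' q).const_smul _
  have hfeas : x₀s = wsum xs := by
    have h1 : Tendsto (fun k => y (k + 1)) atTop (𝓝 (ys + ρ • (x₀s - wsum xs))) := by
      simp only [hiter.y_update]
      exact hy'.add (((hx₀'.comp (tendsto_add_atTop_nat 1)).sub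
        (hws.comp (tendsto_add_atTop_nat 1))).const_smul ρ)
    have h2 := tendsto_nhds_unique h1 (hy'.comp (tendsto_add_atTop_nat 1))
    rw [add_eq_left, smul_eq_zero] at h2
    exact sub_eq_zero.1 (h2.resolve_left hρ0.ne')
  have hys : ys = h - gram H x₀s := by
    refine tendsto_nhds_unique (hy'.comp (tendsto_add_atTop_nat 1)) ?_
    refine Tendsto.congr (fun k => (hyG k).symm) ?_
    exact tendsto_const_nhds.sub
      ((gram H).continuous.tendsto _ |>.comp (hx₀'.comp (tendsto_add_atTop_nat 1)))
  refine ⟨xs, x₀s, ys, hx', hx₀', hy', hfeas, fun q => ?_, fun q v hv => ?_⟩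
  · exact (isClosed_box U).mem_of_tendsto ((hx' q).comp (tendsto_add_atTop_nat 1))
      (Eventually.of_forall fun k => hxbox k q)
  · have hxn : ∀ i, Tendsto (fun k => x (k + 1) i) atTop (𝓝 (xs i)) := fun i =>
      (hx' i).comp (tendsto_add_atTop_nat 1)
    have hg : Tendsto (fun k => sweepGradient w α ρ (x k) (x (k + 1)) (x₀ k) (y k) q) atTop
        (𝓝 (sweepGradient w α ρ xs xs x₀s ys q)) := by
      unfold sweepGradient
      refine Tendsto.add (Tendsto.sub ((hxn q).const_smul _).neg (Tendsto.const_smul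
        (((hx₀'.sub (tendsto_finsetSum _ fun i _ => (hxn i).const_smul _)).const_smul _).add hy')
        _)) (Tendsto.const_smul (tendsto_finsetSum _ fun i _ =>
          ((hx' i).sub (hxn i)).const_smul _) _)
    -- At the limit the residual and the sweep differences vanish and `ys = h - gram H x₀s`, so the
    -- sweep gradient becomes that of the objective.
    have hlim : sweepGradient w α ρ xs xs x₀s ys q = blockGradient H r α xs q := by
      have h0 : x₀s - ∑ i, w i • xs i = 0 := sub_eq_zero.2 hfeas
      rw [blockGradient_eq, ← hfeas, ← hh, ← hys, sweepGradient, h0]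
      simp [hw]
    rw [re_inner_eq_real_inner, ← hlim]
    exact ge_of_tendsto' (hg.inner (tendsto_const_nhds.sub (hxn q))) fun k => hvi k q v hv
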